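/- **Setting.** Let $\zeta_1,\zeta_2,\dots$ be real random variables (test statistics) on one probability space. For each $i$ let $(Q_{i,\theta})_{\theta\in\Theta}$, $\Theta\subseteq\mathbb R$, be a family of probability measures on $\mathbb R$ such that $\zeta_i$ has law $Q_{i,\mu_i}$ for some $\mu_i\in\Theta$. Fix $\mu_0\in\Theta$; the $i$th null hypothesis is $\mu_i=\mu_0$. Let $F_i$ be the CDF of $Q_{i,\mu_0}$, let $p_i=1-F_i(\zeta_i)$, and for $t\in[0,1]$ put $$R_m(t)=\sum_{i=1}^m 1\{p_i\le t\},\qquad V_m(t)=\sum_{i\in I_{0,m}}1\{p_i\le t\},\qquad I_{0,m}=\{i\le m:\mu_i=\mu_0\},\quad m_0=|I_{0,m}|.$$ Let $\rho_{ij}$ be the correlation of $\zeta_i$ and $\zeta_j$, and $\|\mathbf R\|_1=\sum_{i,j=1}^m|\rho_{ij}|$. **Lancaster distributions.** Write $(a)_n=a(a+1)\cdots(a+n-1)$, $$L_n^{(a)}(x)=\sum_{k=0}^n\binom{n+a}{n-k}\frac{(-x)^k}{k!},\qquad C_n(x;a)=\sqrt{\tfrac{a^n}{n!}}\sum_{k=0}^n(-1)^k\binom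 nk\binom xk\frac{k!}{a^k},$$ $$M_n^{\beta,c}(x)=\sqrt{\tfrac{c^n(\beta)_n}{n!}}\sum_{k=0}^n\frac{(-n)_k(-x)_k}{(\beta)_k\,k!}(1-c^{-1})^k,$$ and $g(y;\alpha)=y^{\alpha-1}e^{-y}/\Gamma(\alpha)$ for $y>0$, $\pi(x;a)=a^xe^{-a}/x!$ and $f(x;\beta,c)=(1-c)^\beta c^x(\beta)_x/x!$ for $x\in\mathbb N_0$. A pair $(X,Y)$ has, with correlation $\rho$, 1. the Lancaster bivariate gamma distribution with shape $\alpha$ if $\rho\in[0,1)$ and its density on $(0,\infty)^2$ is $g(x;\alpha)g(y;\alpha)\sum_{n\ge0}\rho^n\frac{n!\,\Gamma(\alpha)}{\Gamma(\alpha+n)}L_n^{(\alpha-1)}(x)L_n^{(\alpha-1)}(y)$; 2. the Lancaster bivariate Poisson distribution with parameter $a$ if $\rho\in[0,1]$ and its probability mass function on $\mathbb N_0^2$ is $\pi(x;a)\pi(y;a)\sum_{n\ge0}\rho^nC_n(x;a)C_n(y;a)$; 3. the Lancaster bivariate negative binomial distribution with parameter $(\beta,c)$ if $\rho\in[0,1)$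 and its probability mass function on $\mathbb N_0^2$ is $f(x;\beta,c)f(y;\beta,c)\sum_{n\ge0}\rho^nM_n^{\beta,c}(x)M_n^{\beta,c}(y)$; 4. the Lancaster bivariate gamma–negative binomial distribution with parameter $(\beta,c,\alpha)$ if $\rho\in[0,\sqrt c]$ and its density with respect to (counting measure on $\mathbb N_0$)$\,\times\,$(Lebesgue measure on $(0,\infty)$) is $f(x;\beta,c)g(y;\alpha)\sum_{n\ge0}\rho^n\sqrt{\frac{n!}{(\alpha)_n}}\,L_n^{(\alpha-1)}(y)M_n^{\beta,c}(x)$ (it being understood that the function in question is a probability density). **Theorem.** For every $t\in[0,1]$ there is a constant $C>0$ such that the following holds in every setting as above in which each pair $(\zeta_i,\zeta_j)$, $i\ne j$, follows, in one of its two orders, one of the distributions: 1 with some $\alpha\in(0,1]$; 2 with some $a>0$; 3 with some $\beta>0$, $0<c<1$; 4 with some $\beta>0$, $0<c<1$, $\alpha>0$; in each case with correlation $\rho_{ij}$. (a) $\left|\mathrm{cov}\left(1\{p_i\le t\},1\{p_j\le t\}\right)\right|\le C|\rho_{ij}|$ for all $i\ne j$. (b) If $m^{-2}\|\mathbf R\|_1=O(m^{-\delta})$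 as $m\to\infty$ for some $\delta>0$, then, almost surely, $$\lim_{m\to\infty}\left|m^{-1}R_m(t)-\mathbb E[m^{-1}R_m(t)]\right|=0,\qquad \lim_{m\to\infty}\left|m^{-1}V_m(t)-\mathbb E[m^{-1}V_m(t)]\right|=0.$$ (c) If in addition $\liminf_{m\to\infty}m_0/m>0$, then $\lim_{m\to\infty}\left|m_0^{-1}V_m(t)-\mathbb E[m_0^{-1}V_m(t)]\right|=0$ almost surely. -/

import Mathlib

open MeasureTheory ProbabilityTheory Filter Topology Asymptotics

namespace Lancaster

noncomputable section

/-! ### Orthogonal polynomials and marginal densities -/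

/-- Pochhammer symbol `(a)_n = a (a+1) ⋯ (a+n-1)`. -/
def poch (a : ℝ) (n : ℕ) : ℝ := (ascPochhammer ℝ n).eval a

/-- Generalized Laguerre polynomial
`L_n^{(a)}(x) = ∑_{k=0}^n binom(n+a, n-k) (-x)^k / k!`. -/
def laguerre (a : ℝ) (n : ℕ) (x : ℝ) : ℝ :=
  ∑ k ∈ Finset.range (n + 1), Ring.choose ((n : ℝ) + a) (n - k) * (-x) ^ k / (k.factorial : ℝ)

/-- Normalized Charlier polynomial of degree `n`. -/
def charlier (a : ℝ) (n x : ℕ) : ℝ :=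
  Real.sqrt (a ^ n / (n.factorial : ℝ)) *
    ∑ k ∈ Finset.range (n + 1),
      (-1 : ℝ) ^ k * (n.choose k : ℝ) * (x.choose k : ℝ) * ((k.factorial : ℝ) / a ^ k)

/-- Normalized Meixner polynomial of degree `n`. -/
def meixner (β c : ℝ) (n x : ℕ) : ℝ :=
  Real.sqrt (c ^ n * poch β n / (n.factorial : ℝ)) *
    ∑ k ∈ Finset.range (n + 1),
      poch (-(n : ℝ)) k * poch (-(x : ℝ)) k / (poch β k * (k.factorial : ℝ)) * (1 - c⁻¹) ^ k

/-- Gamma density with shape `α` and unit scale (used for `x > 0`). -/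
def gammaDensity (α x : ℝ) : ℝ := x ^ (α - 1) * Real.exp (-x) / Real.Gamma α

/-- Poisson probability mass function with mean `a`. -/
def poissonPmf (a : ℝ) (x : ℕ) : ℝ := a ^ x * Real.exp (-a) / (x.factorial : ℝ)

/-- Negative binomial probability mass function. -/
def negBinPmf (β c : ℝ) (x : ℕ) : ℝ := (1 - c) ^ β * (c ^ x * poch β x / (x.factorial : ℝ))

/-! ### The four joint densities -/

def gammaJoint (α ρ : ℝ) (z : ℝ × ℝ) : ℝ :=
  gammaDensity α z.1 * gammaDensity α z.2 *
    ∑' n : ℕ, ρ ^ n * ((n.factorial : ℝ) * Real.Gamma α / Real.Gamma (α + n)) *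
      laguerre (α - 1) n z.1 * laguerre (α - 1) n z.2

def poissonJoint (a ρ : ℝ) (z : ℕ × ℕ) : ℝ :=
  poissonPmf a z.1 * poissonPmf a z.2 *
    ∑' n : ℕ, ρ ^ n * charlier a n z.1 * charlier a n z.2

def negBinJoint (β c ρ : ℝ) (z : ℕ × ℕ) : ℝ :=
  negBinPmf β c z.1 * negBinPmf β c z.2 *
    ∑' n : ℕ, ρ ^ n * meixner β c n z.1 * meixner β c n z.2

/-- First coordinate negative binomial, second coordinate gamma. -/
def gammaNegBinJoint (β c α ρ : ℝ) (z : ℕ × ℝ) : ℝ :=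
  negBinPmf β c z.1 * gammaDensity α z.2 *
    ∑' n : ℕ, ρ ^ n * Real.sqrt ((n.factorial : ℝ) / poch α n) *
      laguerre (α - 1) n z.2 * meixner β c n z.1

/-- Lebesgue measure on `(0, ∞)`. -/
def lebPos : Measure ℝ := volume.restrict (Set.Ioi 0)

/-- The measure `κ` on the plane has density `h` with respect to the measure `ref`
on `E`, where `E` is placed in the plane by `emb`. -/
def HasJointDensity {E : Type*} [MeasurableSpace E] (κ : Measure (ℝ × ℝ))
    (ref : Measure E) (emb : E → ℝ × ℝ) (h : E → ℝ) : Prop :=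
  (∀ᵐ z ∂ref, 0 ≤ h z) ∧
    κ = (ref.withDensity fun z => ENNReal.ofReal (h z)).map emb

/-! ### The four Lancaster bivariate distributions -/

/-- `κ` is the Lancaster bivariate gamma law with shape `α` and correlation `ρ`. -/
def IsBivariateGamma (α ρ : ℝ) (κ : Measure (ℝ × ℝ)) : Prop :=
  0 ≤ ρ ∧ ρ < 1 ∧ HasJointDensity κ (lebPos.prod lebPos) id (gammaJoint α ρ)

/-- `κ` is the Lancaster bivariate Poisson law with parameter `a` and correlation `ρ`. -/
def IsBivariatePoisson (a ρ : ℝ) (κ : Measure (ℝ × ℝ)) : Prop :=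
  0 ≤ ρ ∧ ρ ≤ 1 ∧
    HasJointDensity κ ((Measure.count : Measure ℕ).prod (Measure.count : Measure ℕ))
      (fun z => ((z.1 : ℝ), (z.2 : ℝ))) (poissonJoint a ρ)

/-- `κ` is the Lancaster bivariate negative binomial law with parameter `(β, c)` and
correlation `ρ`. -/
def IsBivariateNegBin (β c ρ : ℝ) (κ : Measure (ℝ × ℝ)) : Prop :=
  0 ≤ ρ ∧ ρ < 1 ∧
    HasJointDensity κ ((Measure.count : Measure ℕ).prod (Measure.count : Measure ℕ))
      (fun z => ((z.1 : ℝ), (z.2 : ℝ))) (negBinJoint β c ρ)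

/-- `κ` is the Lancaster bivariate gamma-negative binomial law with parameter `(β, c, α)` and
correlation `ρ`; the first marginal is negative binomial and the second one is gamma. -/
def IsBivariateGammaNegBin (β c α ρ : ℝ) (κ : Measure (ℝ × ℝ)) : Prop :=
  0 ≤ ρ ∧ ρ ≤ Real.sqrt c ∧
    HasJointDensity κ ((Measure.count : Measure ℕ).prod lebPos)
      (fun z => ((z.1 : ℝ), z.2)) (gammaNegBinJoint β c α ρ)

/-- `κ` is one of the four Lancaster laws, with correlation `ρ` and admissible parameters. -/
def IsLancaster (ρ : ℝ) (κ : Measure (ℝ × ℝ)) : Prop :=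
  (∃ α : ℝ, 0 < α ∧ α ≤ 1 ∧ IsBivariateGamma α ρ κ) ∨
  (∃ a : ℝ, 0 < a ∧ IsBivariatePoisson a ρ κ) ∨
  (∃ β c : ℝ, 0 < β ∧ 0 < c ∧ c < 1 ∧ IsBivariateNegBin β c ρ κ) ∨
  (∃ β c α : ℝ, 0 < β ∧ 0 < c ∧ c < 1 ∧ 0 < α ∧ IsBivariateGammaNegBin β c α ρ κ)

/-! ### Multiple testing -/

/-- Pearson correlation coefficient. -/
def corr {Ω : Type*} [MeasurableSpace Ω] (P : Measure Ω) (X Y : Ω → ℝ) : ℝ :=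
  cov[X, Y; P] / (Real.sqrt Var[X; P] * Real.sqrt Var[Y; P])

/-- A sequence of test statistics `ζ i`. The statistic `ζ i` has the distribution
`law i (μ i)`, where `θ ↦ law i θ` (`θ ∈ Θ`) are its possible distributions, and the `i`-th null
hypothesis is `μ i = μ₀`. -/
structure TestingProblem {Ω : Type*} [MeasurableSpace Ω] (P : Measure Ω) where
  ζ : ℕ → Ω → ℝ
  measurable_ζ : ∀ i, Measurable (ζ i)
  Θ : Set ℝ
  μ₀ : ℝ
  μ₀_mem : μ₀ ∈ Θ
  μ : ℕ → ℝ
  μ_mem : ∀ i, μ i ∈ Θ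
  law : ℕ → ℝ → Measure ℝ
  isProbabilityMeasure_law : ∀ i, ∀ θ ∈ Θ, IsProbabilityMeasure (law i θ)
  map_ζ : ∀ i, P.map (ζ i) = law i (μ i)

namespace TestingProblem

variable {Ω : Type*} [MeasurableSpace Ω] {P : Measure Ω} (T : TestingProblem P)

/-- The correlation of `ζ i` and `ζ j`. -/
def ρ (i j : ℕ) : ℝ := corr P (T.ζ i) (T.ζ j)

/-- The entrywise `l₁`-norm of the correlation matrix of the first `m` statistics. -/
def corrNorm (m : ℕ) : ℝ := ∑ i ∈ Finset.range m, ∑ j ∈ Finset.range m, |T.ρ i j|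

/-- Every pair, taken in one of its two orders, has a Lancaster law with its own correlation.
(The order matters only for the gamma-negative binomial law.) -/
def PairwiseLancaster : Prop :=
  ∀ i j : ℕ, i ≠ j →
    IsLancaster (T.ρ i j) (P.map fun ω => (T.ζ i ω, T.ζ j ω)) ∨
    IsLancaster (T.ρ i j) (P.map fun ω => (T.ζ j ω, T.ζ i ω))

/-- One-sided p-value: one minus the null CDF evaluated at the statistic. -/
def pValue (i : ℕ) (ω : Ω) : ℝ := 1 - cdf (T.law i T.μ₀) (T.ζ i ω)

/-- The indicator of the rejection of the `i`-th null hypothesis at threshold `t`. -/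
def reject (t : ℝ) (i : ℕ) : Ω → ℝ := Set.indicator {ω | T.pValue i ω ≤ t} 1

open Classical in
/-- The indices of the true null hypotheses among the first `m`. -/
def trueNulls (m : ℕ) : Finset ℕ := (Finset.range m).filter fun i => T.μ i = T.μ₀

/-- The number of true null hypotheses among the first `m`. -/
def m₀ (m : ℕ) : ℕ := (T.trueNulls m).card

/-- The number of rejections. -/
def R (t : ℝ) (m : ℕ) (ω : Ω) : ℝ := ∑ i ∈ Finset.range m, T.reject t i ω

/-- The number of false discoveries. -/
def V (t : ℝ) (m : ℕ) (ω : Ω) : ℝ := ∑ i ∈ T.trueNulls m, T.reject t i ω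

end TestingProblem

/-- `|Y m - E[Y m]| → 0` almost surely. -/
def ConvergesToMean {Ω : Type*} [MeasurableSpace Ω] (P : Measure Ω) (Y : ℕ → Ω → ℝ) : Prop :=
  ∀ᵐ ω ∂P, Tendsto (fun m => |Y m ω - ∫ ω', Y m ω' ∂P|) atTop (𝓝 0)

end

end Lancaster

/-!
Each Lancaster law has a density `∑ₙ ρⁿ φₙ(x) ψₙ(y)` with respect to the product of its marginals,
where `φ` and `ψ` are orthonormal polynomials with `φ₀ = ψ₀ = 1`. The covariance of two events is
therefore `∑_{n ≥ 1} ρⁿ aₙ bₙ`, where `aₙ` and `bₙ` are the coefficients of their indicators, and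
Bessel's inequality bounds it by `|ρ|`. So the variance of the average rejection rate is
`O(m ^ (-min δ 1))`; Borel–Cantelli gives convergence along `m = k ^ q`, and monotonicity of the
partial sums fills the gaps.

Orthonormality comes from forward differences: up to normalisation each polynomial is
`Δⁿ ψ_k(x)` at `k = 0` for normalised (falling) powers `ψ_k`, and the Gram matrix satisfies
`Δⁿ_k ⟨ψ_j, ψ_k⟩ = j (j-1) ⋯ (j-n+1) hₙ` at `k = 0`, which `Δᵐ_j` annihilates for `m ≠ n`.
-/

namespace Lancaster

open Finset.HasAntidiagonal (antidiagonal mem_antidiagonal)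
open scoped fwdDiff

/-! ### Factorial powers and forward differences -/

lemma poch_zero (a : ℝ) : poch a 0 = 1 := by simp [poch]

lemma poch_succ (a : ℝ) (n : ℕ) : poch a (n + 1) = poch a n * (a + n) := by
  simp [poch, ascPochhammer_succ_eval]

lemma poch_succ_left (a : ℝ) (n : ℕ) : poch a (n + 1) = a * poch (a + 1) n := by
  simp [poch, ascPochhammer_succ_left]

lemma poch_pos {a : ℝ} (ha : 0 < a) (n : ℕ) : 0 < poch a n := ascPochhammer_pos n a ha

lemma poch_add (a : ℝ) (m n : ℕ) : poch a (m + n) = poch a m * poch (a + m) n := by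
  simp [poch, ← ascPochhammer_mul]

lemma ringChoose_eq_poch_div (a : ℝ) (n : ℕ) :
    Ring.choose a n = poch (a - n + 1) n / n.factorial := by
  rw [Ring.choose_eq_smul, Polynomial.descPochhammer_smeval_eq_ascPochhammer,
    Polynomial.ascPochhammer_smeval_cast, Polynomial.ascPochhammer_smeval_eq_eval, poch,
    smul_eq_mul, div_eq_inv_mul]

/-- Falling factorial power `x (x-1) ⋯ (x-n+1)`, the counterpart of `poch` in which the monomials
of the Charlier and Meixner polynomials and all Gram matrices below are expressed. -/
noncomputable def fall (x : ℝ) (n : ℕ) : ℝ := (descPochhammer ℝ n).eval x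

lemma fall_zero (x : ℝ) : fall x 0 = 1 := by simp [fall]

lemma fall_succ (x : ℝ) (n : ℕ) : fall x (n + 1) = fall x n * (x - n) :=
  descPochhammer_succ_eval n x

lemma fall_succ_left (x : ℝ) (n : ℕ) : fall x (n + 1) = x * fall (x - 1) n := by
  simp [fall, descPochhammer_succ_left]

lemma fall_add (x : ℝ) (m n : ℕ) : fall x (m + n) = fall x m * fall (x - m) n := by
  simp [fall, ← descPochhammer_mul]

lemma fall_natCast (m n : ℕ) : fall m n = m.descFactorial n :=
  descPochhammer_eval_eq_descFactorial ℝ m n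

lemma fall_natCast_eq_factorial_mul_choose (m n : ℕ) : fall m n = n.factorial * m.choose n := by
  rw [fall_natCast, Nat.descFactorial_eq_factorial_mul_choose, Nat.cast_mul]

lemma poch_neg (x : ℝ) (n : ℕ) : poch (-x) n = (-1) ^ n * fall x n :=
  ascPochhammer_eval_neg_eq_descPochhammer ℝ x n

lemma sum_antidiagonal_succ_choose_mul (F : ℕ → ℕ → ℝ) (n : ℕ) :
    ∑ p ∈ antidiagonal (n + 1), ((n + 1).choose p.1 : ℝ) * F p.1 p.2 =
      ∑ p ∈ antidiagonal n, (n.choose p.1 : ℝ) * (F (p.1 + 1) p.2 + F p.1 (p.2 + 1)) := by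
  rw [Finset.sum_antidiagonal_choose_succ_mul, add_comm, ← Finset.sum_add_distrib]
  refine Finset.sum_congr rfl fun p hp => ?_
  rw [← Nat.choose_symm_of_eq_add (mem_antidiagonal.1 hp).symm, mul_add]

lemma add_fall (x y : ℝ) (n : ℕ) :
    fall (x + y) n = ∑ p ∈ antidiagonal n, (n.choose p.1 : ℝ) * (fall x p.1 * fall y p.2) := by
  induction n with
  | zero => simp [fall_zero]
  | succ n ih =>
    rw [sum_antidiagonal_succ_choose_mul fun i l => fall x i * fall y l, fall_succ, ih,
      Finset.sum_mul]
    refine Finset.sum_congr rfl fun p hp => ?_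
    have hn : (p.1 : ℝ) + p.2 = n := mod_cast mem_antidiagonal.1 hp
    rw [fall_succ, fall_succ, ← hn]
    ring

lemma fall_mul_fall (x : ℝ) (j k : ℕ) :
    fall x j * fall x k =
      ∑ p ∈ antidiagonal k, (k.choose p.1 : ℝ) * (fall j p.1 * fall x (j + p.2)) := by
  rw [← add_sub_cancel (j : ℝ) x, add_fall j (x - j) k, add_sub_cancel, Finset.mul_sum]
  simp_rw [fall_add]
  exact Finset.sum_congr rfl fun p _ => by ring

lemma fwdDiff_iter_mul_left (n : ℕ) (c : ℝ) (f : ℕ → ℝ) (k : ℕ) :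
    Δ_[1] ^[n] (fun k => c * f k) k = c * Δ_[1] ^[n] f k :=
  congrFun (fwdDiff_iter_const_smul (h := 1) c f n) k

lemma sum_neg_one_pow_mul_choose_mul (n : ℕ) (f : ℕ → ℝ) :
    ∑ k ∈ Finset.range (n + 1), (-1) ^ k * (n.choose k : ℝ) * f k = (-1) ^ n * Δ_[1] ^[n] f 0 := by
  rw [fwdDiff_iter_eq_sum_shift, Finset.mul_sum]
  refine Finset.sum_congr rfl fun k hk => ?_
  obtain ⟨l, rfl⟩ := Nat.exists_eq_add_of_le (Finset.mem_range_succ_iff.1 hk)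
  rw [Nat.add_sub_cancel_left, zero_add, smul_eq_mul, mul_one, zsmul_eq_mul, pow_add]
  push_cast
  have : ((-1 : ℝ) ^ l) * (-1) ^ l = 1 := by rw [← mul_pow]; simp
  linear_combination -(-1) ^ k * ((k + l).choose k : ℝ) * f k * this

lemma fwdDiff_fall_succ (n : ℕ) :
    Δ_[1] (fun k : ℕ => fall k (n + 1)) = fun k : ℕ => (n + 1) * fall k n := by
  funext k
  rw [fwdDiff, fall_succ_left, Nat.cast_add_one,
    add_sub_cancel_right, fall_succ]
  ring

lemma fwdDiff_iter_fall_zero (m n : ℕ) :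
    Δ_[1] ^[m] (fun k : ℕ => fall k n) 0 = if m = n then (n.factorial : ℝ) else 0 := by
  induction m generalizing n with
  | zero => cases n <;> simp [fall_zero, fall_succ_left]
  | succ m ih =>
    cases n with
    | zero =>
      simp only [Function.iterate_succ_apply, fall_zero, fwdDiff_const]
      simpa using fwdDiff_iter_mul_left m 0 (fun _ => 0) 0
    | succ n =>
      rw [Function.iterate_succ_apply, fwdDiff_fall_succ, fwdDiff_iter_mul_left, ih]
      simp [Nat.factorial_succ]

lemma fwdDiff_iter_poch_add_div_poch {a : ℝ} (ha : 0 < a) (d : ℝ) (n : ℕ) :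
    Δ_[1] ^[n] (fun k => poch (a + d) k / poch a k) 0 = fall d n / poch a n := by
  induction n generalizing a d with
  | zero => simp [poch_zero, fall_zero]
  | succ n ih =>
    have hΔ : Δ_[1] (fun k => poch (a + d) k / poch a k) =
        fun k => d / a * (poch (a + 1 + (d - 1)) k / poch (a + 1) k) := by
      funext k
      have hk := poch_pos ha k
      have : 0 < a + k := by positivity
      have hshift : poch (a + 1) k = poch a k * (a + k) / a := by
        rw [← poch_succ, poch_succ_left, mul_div_cancel_left₀ _ ha.ne']
      rw [fwdDiff, poch_succ, poch_succ, hshift, add_add_sub_cancel]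
      field_simp
      ring
    rw [Function.iterate_succ_apply, hΔ, fwdDiff_iter_mul_left, ih (by linarith),
      fall_succ_left, poch_succ_left, div_mul_div_comm]

lemma fwdDiff_iter_sum_antidiagonal (F : ℕ → ℕ → ℝ) (n : ℕ) :
    Δ_[1] ^[n] (fun k => ∑ p ∈ antidiagonal k, (k.choose p.1 : ℝ) * F p.1 p.2) 0 =
      ∑ p ∈ antidiagonal n, (n.choose p.1 : ℝ) * Δ_[1] ^[p.2] (F p.1) 0 := by
  induction n generalizing F with
  | zero => simp
  | succ n ih =>
    have hΔ : Δ_[1] (fun k => ∑ p ∈ antidiagonal k, (k.choose p.1 : ℝ) * F p.1 p.2) =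
        (fun k => ∑ p ∈ antidiagonal k, (k.choose p.1 : ℝ) * F (p.1 + 1) p.2) +
          fun k => ∑ p ∈ antidiagonal k, (k.choose p.1 : ℝ) * Δ_[1] (F p.1) p.2 := by
      funext k
      simp only [fwdDiff, sum_antidiagonal_succ_choose_mul, Pi.add_apply,
        ← Finset.sum_add_distrib, ← Finset.sum_sub_distrib]
      exact Finset.sum_congr rfl fun p _ => by ring
    rw [Function.iterate_succ_apply, hΔ, fwdDiff_iter_add, Pi.add_apply, ih (fun i => F (i + 1)),
      ih (fun i => Δ_[1] (F i)), sum_antidiagonal_succ_choose_mul fun i l => Δ_[1] ^[l] (F i) 0,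
      ← Finset.sum_add_distrib]
    simp only [mul_add, Function.iterate_succ_apply]

lemma fwdDiff_iter_sum_choose_mul (a : ℕ → ℝ) (n : ℕ) :
    Δ_[1] ^[n] (fun k => ∑ p ∈ antidiagonal k, (k.choose p.1 : ℝ) * a p.1) 0 = a n := by
  rw [fwdDiff_iter_sum_antidiagonal fun i _ => a i, Finset.sum_eq_single_of_mem (n, 0) (by simp)]
  · simp
  · rintro ⟨i, _ | l⟩ hp hne
    · exact absurd (by simpa using hp) hne
    · simpa using Or.inr (fwdDiff_iter_mul_left l 0 (fun _ => 0) 0)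

lemma fwdDiff_iter_sum_choose_mul_poch_div_poch {b : ℝ} (hb : 0 < b) (d s : ℝ) (n : ℕ) :
    Δ_[1] ^[n] (fun k => (∑ p ∈ antidiagonal k,
        (k.choose p.1 : ℝ) * (fall d p.1 * s ^ p.1 * poch (b + d) p.2)) / poch b k) 0 =
      fall d n * ((1 + s) ^ n / poch b n) := by
  have hsplit : (fun k => (∑ p ∈ antidiagonal k,
        (k.choose p.1 : ℝ) * (fall d p.1 * s ^ p.1 * poch (b + d) p.2)) / poch b k) =
      fun k => ∑ p ∈ antidiagonal k, (k.choose p.1 : ℝ) *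
        (fall d p.1 * s ^ p.1 / poch b p.1 *
          (poch (b + p.1 + (d - p.1)) p.2 / poch (b + p.1) p.2)) := by
    funext k
    rw [Finset.sum_div]
    refine Finset.sum_congr rfl fun p hp => ?_
    rw [← mem_antidiagonal.1 hp, poch_add, add_add_sub_cancel]
    field_simp
  rw [hsplit, fwdDiff_iter_sum_antidiagonal fun i l =>
    fall d i * s ^ i / poch b i * (poch (b + i + (d - i)) l / poch (b + i) l), add_comm 1 s,
    (Commute.all s 1).add_pow', Finset.sum_div, Finset.mul_sum]
  refine Finset.sum_congr rfl fun p hp => ?_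
  rw [fwdDiff_iter_mul_left, fwdDiff_iter_poch_add_div_poch (by positivity),
    ← mem_antidiagonal.1 hp, fall_add, poch_add, one_pow, nsmul_eq_mul]
  field_simp

/-! ### Orthonormal systems -/

/-- A sequence of functions, starting with the constant `1`, that is orthonormal in `L²(ν)`. The
polynomials of the Lancaster laws form such systems for the marginal laws `ν`. -/
structure IsOrthonormalSystem {E : Type*} [MeasurableSpace E] (ν : Measure E) (φ : ℕ → E → ℝ) :
    Prop where
  zero : ∀ x, φ 0 x = 1
  memLp : ∀ n, MemLp (φ n) 2 ν
  integral_mul : ∀ m n, ∫ x, φ m x * φ n x ∂ν = if m = n then 1 else 0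

namespace IsOrthonormalSystem

variable {E : Type*} [MeasurableSpace E] {ν : Measure E} {φ : ℕ → E → ℝ}

lemma isProbabilityMeasure (hφ : IsOrthonormalSystem ν φ) : IsProbabilityMeasure ν := by
  rw [isProbabilityMeasure_iff_real]
  simpa [hφ.zero] using hφ.integral_mul 0 0

lemma integral_eq (hφ : IsOrthonormalSystem ν φ) (n : ℕ) :
    ∫ x, φ n x ∂ν = if n = 0 then 1 else 0 := by
  simpa [hφ.zero] using hφ.integral_mul n 0

lemma integrable (hφ : IsOrthonormalSystem ν φ) (n : ℕ) : Integrable (φ n) ν :=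
  have := hφ.isProbabilityMeasure
  (hφ.memLp n).integrable one_le_two

lemma integral_abs_le_one (hφ : IsOrthonormalSystem ν φ) (n : ℕ) : ∫ x, |φ n x| ∂ν ≤ 1 := by
  have := hφ.isProbabilityMeasure
  have hsq : Integrable (fun x => φ n x ^ 2) ν := (hφ.memLp n).integrable_sq
  calc ∫ x, |φ n x| ∂ν
      ≤ ∫ x, (1 + φ n x ^ 2) / 2 ∂ν := by
        refine integral_mono (hφ.integrable n).abs (((integrable_const 1).add hsq).div_const 2)
          fun x => ?_
        have := two_mul_le_add_sq 1 |φ n x|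
        rw [sq_abs] at this
        linarith
    _ = 1 := by
        rw [integral_div, integral_add (integrable_const 1) hsq]
        simp [pow_two, hφ.integral_mul]

lemma orthonormal_toLp (hφ : IsOrthonormalSystem ν φ) :
    Orthonormal ℝ fun n => (hφ.memLp n).toLp := by
  rw [orthonormal_iff_ite]
  intro m n
  rw [← hφ.integral_mul, L2.inner_def]
  refine integral_congr_ae ?_
  filter_upwards [(hφ.memLp m).coeFn_toLp, (hφ.memLp n).coeFn_toLp] with x hm hn
  simp [hm, hn, mul_comm]

lemma sum_sq_setIntegral_le_one (hφ : IsOrthonormalSystem ν φ) (I : Finset ℕ) {S : Set E}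
    (hS : MeasurableSet S) : ∑ n ∈ I, (∫ x in S, φ n x ∂ν) ^ 2 ≤ 1 := by
  have := hφ.isProbabilityMeasure
  have hbessel := hφ.orthonormal_toLp.sum_inner_products_le (s := I)
    (indicatorConstLp 2 hS (measure_ne_top ν S) 1)
  have hcoeff : ∀ n, inner ℝ (hφ.memLp n).toLp (indicatorConstLp 2 hS (measure_ne_top ν S) 1) =
      ∫ x in S, φ n x ∂ν := fun n => by
    rw [real_inner_comm, L2.inner_indicatorConstLp_one]
    exact integral_congr_ae (ae_restrict_of_ae (hφ.memLp n).coeFn_toLp)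
  simp only [hcoeff, Real.norm_eq_abs, sq_abs] at hbessel
  rw [← real_inner_self_eq_norm_sq,
    L2.real_inner_indicatorConstLp_one_indicatorConstLp_one hS hS] at hbessel
  exact hbessel.trans measureReal_le_one

lemma sum_abs_setIntegral_mul_le_one {F : Type*} [MeasurableSpace F] {ν' : Measure F}
    {φ' : ℕ → F → ℝ} (hφ : IsOrthonormalSystem ν φ) (hφ' : IsOrthonormalSystem ν' φ')
    (I : Finset ℕ) {S : Set E} {S' : Set F} (hS : MeasurableSet S) (hS' : MeasurableSet S') :
    ∑ n ∈ I, |(∫ x in S, φ n x ∂ν) * ∫ y in S', φ' n y ∂ν'| ≤ 1 := by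
  have hamgm : ∀ a b : ℝ, |a * b| ≤ (a ^ 2 + b ^ 2) / 2 := fun a b => by
    rw [abs_mul, ← sq_abs a, ← sq_abs b]
    linarith [two_mul_le_add_sq |a| |b|]
  calc _ ≤ ∑ n ∈ I, ((∫ x in S, φ n x ∂ν) ^ 2 + (∫ y in S', φ' n y ∂ν') ^ 2) / 2 :=
        Finset.sum_le_sum fun n _ => hamgm _ _
    _ ≤ 1 := by
        rw [← Finset.sum_div, Finset.sum_add_distrib]
        linarith [hφ.sum_sq_setIntegral_le_one I hS, hφ'.sum_sq_setIntegral_le_one I hS']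

end IsOrthonormalSystem

section FwdDiff

variable {E : Type*} [MeasurableSpace E] {ν : Measure E}

lemma memLp_fwdDiff_iter {ψ : ℕ → E → ℝ} (hψ : ∀ k, MemLp (ψ k) 2 ν) (n : ℕ) :
    MemLp (fun x => Δ_[1] ^[n] (fun k => ψ k x) 0) 2 ν := by
  simp only [fwdDiff_iter_eq_sum_shift, zsmul_eq_mul]
  exact memLp_finsetSum _ fun k _ => (hψ _).const_mul _

lemma integral_mul_fwdDiff_iter {f : E → ℝ} {ψ : ℕ → E → ℝ}
    (hfψ : ∀ k, Integrable (fun x => f x * ψ k x) ν) (n : ℕ) :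
    ∫ x, f x * Δ_[1] ^[n] (fun k => ψ k x) 0 ∂ν =
      Δ_[1] ^[n] (fun k => ∫ x, f x * ψ k x ∂ν) 0 := by
  simp only [fwdDiff_iter_eq_sum_shift, zsmul_eq_mul, Finset.mul_sum, mul_left_comm (f _)]
  rw [integral_finsetSum _ fun k _ => (hfψ _).const_mul _]
  simp only [integral_const_mul]

/-- Applying `Δᵐ` in `j` to `j (j-1) ⋯ (j-n+1)` at `j = 0` gives `n!` if `m = n` and `0` otherwise,
so the hypothesis on the Gram matrix makes the differences of the `ψ k` orthogonal. -/
theorem IsOrthonormalSystem.of_fwdDiff {ψ : ℕ → E → ℝ} {h s : ℕ → ℝ}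
    (hψ : ∀ k, MemLp (ψ k) 2 ν) (hψ_zero : ∀ x, ψ 0 x = 1)
    (hgram : ∀ j n : ℕ, Δ_[1] ^[n] (fun k => ∫ x, ψ j x * ψ k x ∂ν) 0 = fall j n * h n)
    (hs_zero : s 0 = 1) (hs : ∀ n, s n ^ 2 * (n.factorial * h n) = 1) :
    IsOrthonormalSystem ν fun n x => s n * Δ_[1] ^[n] (fun k => ψ k x) 0 where
  zero x := by simp [hψ_zero, hs_zero]
  memLp n := (memLp_fwdDiff_iter hψ n).const_mul (s n)
  integral_mul m n := by
    have hinner : ∀ j, ∫ x, Δ_[1] ^[n] (fun k => ψ k x) 0 * ψ j x ∂ν = h n * fall j n := fun j => by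
      simp only [mul_comm _ (ψ j _)]
      rw [integral_mul_fwdDiff_iter (fun k => (hψ j).integrable_mul (hψ k)), hgram, mul_comm]
    have horth : ∫ x, Δ_[1] ^[n] (fun k => ψ k x) 0 * Δ_[1] ^[m] (fun k => ψ k x) 0 ∂ν =
        h n * if m = n then (n.factorial : ℝ) else 0 := by
      rw [integral_mul_fwdDiff_iter fun k => (memLp_fwdDiff_iter hψ n).integrable_mul (hψ k)]
      simp only [hinner]
      rw [fwdDiff_iter_mul_left, fwdDiff_iter_fall_zero]
    calc _ = s m * s n *
          ∫ x, Δ_[1] ^[n] (fun k => ψ k x) 0 * Δ_[1] ^[m] (fun k => ψ k x) 0 ∂ν := by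
          rw [← integral_const_mul]
          congr 1 with x
          ring
      _ = if m = n then 1 else 0 := by
          rw [horth]
          split_ifs with hmn
          · rw [hmn, ← hs n]
            ring
          · simp

end FwdDiff

/-! ### Measures given by a weight -/

section Weight

variable {E : Type*} [MeasurableSpace E] {ν : Measure E} {w : E → ℝ}

/-- The measure with density `w` with respect to `ν`. The marginals of the Lancaster laws are of
this form; where `w` is negative the density is cut off at `0`. -/
noncomputable def withWeight (ν : Measure E) (w : E → ℝ) : Measure E :=
  ν.withDensity fun x => ENNReal.ofReal (w x)

lemma integrable_withWeight_iff (hw : Measurable w) (hw₀ : 0 ≤ᵐ[ν] w) {f : E → ℝ} :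
    Integrable f (withWeight ν w) ↔ Integrable (fun x => w x * f x) ν := by
  rw [withWeight, integrable_withDensity_iff_integrable_smul' hw.ennreal_ofReal
    (.of_forall fun _ => ENNReal.ofReal_lt_top)]
  refine integrable_congr ?_
  filter_upwards [hw₀] with x hx
  rw [ENNReal.toReal_ofReal hx, smul_eq_mul]

lemma integral_withWeight (hw : Measurable w) (hw₀ : 0 ≤ᵐ[ν] w) (f : E → ℝ) :
    ∫ x, f x ∂withWeight ν w = ∫ x, w x * f x ∂ν := by
  rw [withWeight, integral_withDensity_eq_integral_toReal_smul hw.ennreal_ofReal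
    (.of_forall fun _ => ENNReal.ofReal_lt_top)]
  refine integral_congr_ae ?_
  filter_upwards [hw₀] with x hx
  rw [ENNReal.toReal_ofReal hx, smul_eq_mul]

lemma HasJointDensity.withWeight {F : Type*} [MeasurableSpace F] {ν' : Measure F} {w' : F → ℝ}
    [SFinite ν] [SFinite ν'] {κ : Measure (ℝ × ℝ)} {emb : E × F → ℝ × ℝ} {S : E × F → ℝ}
    (hw : Measurable w) (hw' : Measurable w') (hS : Measurable S)
    (hw₀ : 0 ≤ᵐ[ν] w) (hw'₀ : 0 ≤ᵐ[ν'] w')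
    (hκ : HasJointDensity κ (ν.prod ν') emb fun z => w z.1 * w' z.2 * S z) :
    HasJointDensity κ ((withWeight ν w).prod (withWeight ν' w')) emb S := by
  have hprod : (Lancaster.withWeight ν w).prod (Lancaster.withWeight ν' w') =
      (ν.prod ν').withDensity fun z => ENNReal.ofReal (w z.1) * ENNReal.ofReal (w' z.2) :=
    prod_withDensity hw.ennreal_ofReal hw'.ennreal_ofReal
  have hmeas : Measurable fun z : E × F => ENNReal.ofReal (w z.1) * ENNReal.ofReal (w' z.2) := by
    fun_prop
  have hw₁ : ∀ᵐ z ∂ν.prod ν', 0 ≤ w z.1 := Measure.quasiMeasurePreserving_fst.ae hw₀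
  have hw₂ : ∀ᵐ z ∂ν.prod ν', 0 ≤ w' z.2 := Measure.quasiMeasurePreserving_snd.ae hw'₀
  obtain ⟨hnonneg, hmap⟩ := hκ
  refine ⟨?_, ?_⟩
  · rw [hprod, ae_withDensity_iff hmeas]
    filter_upwards [hnonneg] with z hz hne
    have hpos := mul_ne_zero_iff.1 hne
    simp only [ne_eq, ENNReal.ofReal_eq_zero, not_le] at hpos
    exact nonneg_of_mul_nonneg_right hz (mul_pos hpos.1 hpos.2)
  · rw [hmap, hprod, ← withDensity_mul _ hmeas hS.ennreal_ofReal]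
    congr 1
    refine withDensity_congr_ae ?_
    filter_upwards [hw₁, hw₂] with z h₁ h₂
    rw [Pi.mul_apply, ENNReal.ofReal_mul (mul_nonneg h₁ h₂), ENNReal.ofReal_mul h₁]

end Weight

/-! ### The Laguerre system -/

lemma Gamma_add_natCast {α : ℝ} (hα : 0 < α) (n : ℕ) :
    Real.Gamma (α + n) = poch α n * Real.Gamma α := by
  induction n with
  | zero => simp [poch_zero]
  | succ n ih =>
    rw [Nat.cast_succ, ← add_assoc, Real.Gamma_add_one (by positivity), ih, poch_succ]
    ring

lemma gammaDensity_nonneg_ae {α : ℝ} (hα : 0 < α) : 0 ≤ᵐ[lebPos] gammaDensity α := by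
  refine (ae_restrict_iff' measurableSet_Ioi).2 (.of_forall fun x (hx : 0 < x) => ?_)
  have := Real.Gamma_pos_of_pos hα
  simp only [Pi.zero_apply, gammaDensity]
  positivity

lemma measurable_gammaDensity (α : ℝ) : Measurable (gammaDensity α) := by
  unfold gammaDensity
  fun_prop

lemma gammaDensity_mul_pow (α : ℝ) (k : ℕ) {x : ℝ} (hx : 0 < x) :
    gammaDensity α x * x ^ k = (Real.Gamma α)⁻¹ * (Real.exp (-x) * x ^ (α + k - 1)) := by
  rw [gammaDensity, add_sub_right_comm, Real.rpow_add_natCast hx.ne']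
  ring

lemma integrable_pow_gamma {α : ℝ} (hα : 0 < α) (k : ℕ) :
    Integrable (fun x => x ^ k) (withWeight lebPos (gammaDensity α)) := by
  rw [integrable_withWeight_iff (measurable_gammaDensity α) (gammaDensity_nonneg_ae hα)]
  have hconv := (Real.GammaIntegral_convergent (show 0 < α + k by positivity)).const_mul
    (Real.Gamma α)⁻¹
  exact IntegrableOn.congr_fun hconv (fun x hx => (gammaDensity_mul_pow α k hx).symm)
    measurableSet_Ioi

lemma integral_pow_gamma {α : ℝ} (hα : 0 < α) (k : ℕ) :
    ∫ x, x ^ k ∂withWeight lebPos (gammaDensity α) = poch α k := by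
  rw [integral_withWeight (measurable_gammaDensity α) (gammaDensity_nonneg_ae hα), lebPos,
    setIntegral_congr_fun measurableSet_Ioi fun x hx => gammaDensity_mul_pow α k hx,
    integral_const_mul, ← Real.Gamma_eq_integral (by positivity), Gamma_add_natCast hα]
  have := (Real.Gamma_pos_of_pos hα).ne'
  field_simp

lemma sqrt_mul_laguerre_eq {α : ℝ} (hα : 0 < α) (n : ℕ) (x : ℝ) :
    √(n.factorial / poch α n) * laguerre (α - 1) n x =
      (-1) ^ n * √(poch α n / n.factorial) * Δ_[1] ^[n] (fun k => x ^ k / poch α k) 0 := by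
  have hlaguerre : laguerre (α - 1) n x = poch α n / n.factorial *
      ∑ k ∈ Finset.range (n + 1), (-1) ^ k * (n.choose k : ℝ) * (x ^ k / poch α k) := by
    rw [laguerre, Finset.mul_sum]
    refine Finset.sum_congr rfl fun k hk => ?_
    obtain ⟨l, rfl⟩ := Nat.exists_eq_add_of_le (Finset.mem_range_succ_iff.1 hk)
    have hfact : ((k + l).factorial : ℝ) = (k + l).choose k * k.factorial * l.factorial :=
      mod_cast
      (Nat.choose_symm_add ▸ Nat.add_choose_mul_factorial_mul_factorial k l).symm
    have hpoch := (poch_pos hα k).ne'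
    have hchoose : ((k + l).choose k : ℝ) ≠ 0 := mod_cast (Nat.choose_pos (by lia)).ne'
    rw [Nat.add_sub_cancel_left, ringChoose_eq_poch_div, poch_add, hfact, neg_pow,
      show ((k + l : ℕ) : ℝ) + (α - 1) - l + 1 = α + k by push_cast; ring]
    field_simp
  have hpos : 0 < poch α n / n.factorial := div_pos (poch_pos hα n) (by positivity)
  rw [hlaguerre, sum_neg_one_pow_mul_choose_mul, ← inv_div, Real.sqrt_inv]
  nth_rw 2 [← Real.mul_self_sqrt hpos.le]
  have := (Real.sqrt_pos.2 hpos).ne'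
  field_simp

theorem isOrthonormalSystem_laguerre {α : ℝ} (hα : 0 < α) :
    IsOrthonormalSystem (withWeight lebPos (gammaDensity α))
      fun n x => √(n.factorial / poch α n) * laguerre (α - 1) n x := by
  simp only [sqrt_mul_laguerre_eq hα]
  have hgram : ∀ j k : ℕ, ∫ x, x ^ j / poch α j * (x ^ k / poch α k)
      ∂withWeight lebPos (gammaDensity α) = poch (α + j) k / poch α k := fun j k => by
    simp only [div_mul_div_comm, ← pow_add]
    rw [integral_div, integral_pow_gamma hα, poch_add, mul_div_mul_left _ _ (poch_pos hα j).ne']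
  refine .of_fwdDiff (h := fun n => (poch α n)⁻¹) (fun k => ?_) (by simp [poch_zero])
    (fun j n => ?_) (by simp [poch_zero]) fun n => ?_
  · refine (memLp_two_iff_integrable_sq (by fun_prop)).2 ?_
    simp only [div_pow, ← pow_mul]
    exact (integrable_pow_gamma hα (k * 2)).div_const _
  · simp only [hgram, fwdDiff_iter_poch_add_div_poch hα, ← div_eq_mul_inv]
  · have := poch_pos hα n
    rw [mul_pow, ← pow_mul', (even_two_mul n).neg_one_pow, Real.sq_sqrt (by positivity)]
    field_simp

/-! ### Factorial moments of weights on `ℕ` -/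

lemma hasSum_mul_fall_of_shift {w w' : ℕ → ℝ} {a : ℝ} (l : ℕ)
    (hw : ∀ x : ℕ, w (x + l) * fall (x + l : ℕ) l = w' x) (h : HasSum w' a) :
    HasSum (fun x : ℕ => w x * fall x l) a := by
  rw [← Function.Injective.hasSum_iff (add_left_injective l)]
  · exact h.congr_fun hw
  · intro x hx
    have hxl : x < l := by
      by_contra! hle
      exact hx ⟨x - l, Nat.sub_add_cancel hle⟩
    rw [fall_natCast, Nat.descFactorial_eq_zero_iff_lt.2 hxl, Nat.cast_zero, mul_zero]

lemma hasSum_mul_fall_mul_fall {w M : ℕ → ℝ}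
    (hM : ∀ l, HasSum (fun x : ℕ => w x * fall x l) (M l)) (j k : ℕ) :
    HasSum (fun x : ℕ => w x * (fall x j * fall x k))
      (∑ p ∈ antidiagonal k, (k.choose p.1 : ℝ) * (fall j p.1 * M (j + p.2))) := by
  simp only [fall_mul_fall, Finset.mul_sum, mul_left_comm (w _)]
  exact hasSum_sum fun p _ => ((hM _).mul_left _).mul_left _

lemma integrable_count_of_summable {f : ℕ → ℝ} (hf : Summable f) :
    Integrable f Measure.count :=
  integrable_count_iff.2 hf.norm

lemma integral_count_of_hasSum {f : ℕ → ℝ} {a : ℝ} (hf : HasSum f a) :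
    ∫ x, f x ∂Measure.count = a := by
  rw [integral_countable (integrable_count_of_summable hf.summable)]
  simpa [measureReal_def] using hf.tsum_eq

lemma integral_fall_mul_fall {w M : ℕ → ℝ} (hw₀ : ∀ x, 0 ≤ w x)
    (hM : ∀ l, HasSum (fun x : ℕ => w x * fall x l) (M l)) (j k : ℕ) :
    ∫ x : ℕ, fall x j * fall x k ∂withWeight .count w =
      ∑ p ∈ antidiagonal k, (k.choose p.1 : ℝ) * (fall j p.1 * M (j + p.2)) := by
  rw [integral_withWeight .of_discrete (.of_forall hw₀)]
  exact integral_count_of_hasSum (hasSum_mul_fall_mul_fall hM j k)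

lemma memLp_fall {w M : ℕ → ℝ} (hw₀ : ∀ x, 0 ≤ w x)
    (hM : ∀ l, HasSum (fun x : ℕ => w x * fall x l) (M l)) (k : ℕ) :
    MemLp (fun x : ℕ => fall x k) 2 (withWeight .count w) := by
  refine (memLp_two_iff_integrable_sq (Measurable.of_discrete.aestronglyMeasurable)).2 ?_
  simp only [sq]
  rw [integrable_withWeight_iff .of_discrete (.of_forall hw₀)]
  exact integrable_count_of_summable (hasSum_mul_fall_mul_fall hM k k).summable

lemma fall_add_natCast_div_factorial (x l : ℕ) :
    fall (x + l : ℕ) l / (x + l).factorial = 1 / x.factorial := by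
  have h : (x.factorial : ℝ) * fall (x + l : ℕ) l = (x + l).factorial := by
    rw [fall_natCast]
    exact_mod_cast Nat.add_sub_cancel x l ▸ Nat.factorial_mul_descFactorial (Nat.le_add_left l x)
  rw [div_eq_div_iff (by positivity) (by positivity)]
  linarith

/-! ### The Charlier system -/

lemma poissonPmf_nonneg {a : ℝ} (ha : 0 ≤ a) (x : ℕ) : 0 ≤ poissonPmf a x := by
  unfold poissonPmf
  positivity

lemma hasSum_poissonPmf (a : ℝ) : HasSum (poissonPmf a) 1 := by
  have h := (NormedSpace.expSeries_div_hasSum_exp (𝔸 := ℝ) a).mul_right (Real.exp (-a))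
  rw [← Real.exp_eq_exp_ℝ, ← Real.exp_add, add_neg_cancel, Real.exp_zero] at h
  exact h.congr_fun fun x => mul_div_right_comm _ _ _

lemma hasSum_poissonPmf_mul_fall (a : ℝ) (l : ℕ) :
    HasSum (fun x : ℕ => poissonPmf a x * fall x l) (a ^ l) := by
  refine hasSum_mul_fall_of_shift l (w' := fun x => a ^ l * poissonPmf a x) (fun x => ?_)
    (by simpa using (hasSum_poissonPmf a).mul_left (a ^ l))
  unfold poissonPmf
  linear_combination a ^ (x + l) * Real.exp (-a) * fall_add_natCast_div_factorial x l

lemma charlier_eq (a : ℝ) (n x : ℕ) :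
    charlier a n x =
      (-1) ^ n * √(a ^ n / n.factorial) * Δ_[1] ^[n] (fun k => fall x k / a ^ k) 0 := by
  rw [mul_comm ((-1) ^ n), mul_assoc, ← sum_neg_one_pow_mul_choose_mul, charlier]
  simp only [fall_natCast_eq_factorial_mul_choose]
  congr 2 with k
  ring

theorem isOrthonormalSystem_charlier {a : ℝ} (ha : 0 < a) :
    IsOrthonormalSystem (withWeight .count (poissonPmf a)) (charlier a) := by
  have hw₀ := poissonPmf_nonneg ha.le
  have hM := hasSum_poissonPmf_mul_fall a
  have hgram : ∀ j k : ℕ, ∫ x : ℕ, fall x j / a ^ j * (fall x k / a ^ k)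
      ∂withWeight .count (poissonPmf a) =
        ∑ p ∈ antidiagonal k, (k.choose p.1 : ℝ) * (fall j p.1 * a⁻¹ ^ p.1) := fun j k => by
    simp only [div_mul_div_comm]
    rw [integral_div, integral_fall_mul_fall hw₀ hM, Finset.sum_div]
    refine Finset.sum_congr rfl fun p hp => ?_
    rw [← mem_antidiagonal.1 hp, inv_pow]
    field_simp
    ring
  refine (funext₂ (charlier_eq a) : charlier a = _) ▸ .of_fwdDiff (h := fun n => a⁻¹ ^ n)
    (fun k => ?_) (by simp [fall_zero]) (fun j n => ?_) (by simp) fun n => ?_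
  · simpa only [div_eq_mul_inv] using (memLp_fall hw₀ hM k).mul_const _
  · simp only [hgram]
    exact fwdDiff_iter_sum_choose_mul (fun i => fall j i * a⁻¹ ^ i) n
  · rw [mul_pow, ← pow_mul', (even_two_mul n).neg_one_pow, Real.sq_sqrt (by positivity), inv_pow]
    field_simp

/-! ### The Meixner system -/

lemma negBinPmf_nonneg {β c : ℝ} (hβ : 0 < β) (hc : 0 ≤ c) (hc1 : c ≤ 1) (x : ℕ) :
    0 ≤ negBinPmf β c x := by
  have := poch_pos hβ x
  have := Real.rpow_nonneg (sub_nonneg.2 hc1) β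
  unfold negBinPmf
  positivity

lemma hasSum_negBinPmf {β c : ℝ} (hc : |c| < 1) : HasSum (negBinPmf β c) 1 := by
  have hc1 : 0 < 1 - c := by linarith [le_abs_self c]
  have h := ((Real.one_div_one_sub_rpow_hasFPowerSeriesOnBall_zero β).hasSum (y := c)
    (by simpa [enorm_eq_nnnorm, ← NNReal.coe_lt_coe] using hc)).mul_left ((1 - c) ^ β)
  rw [zero_add, mul_one_div_cancel (by positivity)] at h
  refine h.congr_fun fun n => ?_
  rw [negBinPmf, FormalMultilinearSeries.ofScalars_apply_eq, ringChoose_eq_poch_div, sub_right_comm,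
    add_sub_cancel_right, sub_add_cancel, smul_eq_mul, mul_comm (c ^ n), div_mul_eq_mul_div]

lemma hasSum_negBinPmf_mul_fall {β c : ℝ} (hc : |c| < 1) (l : ℕ) :
    HasSum (fun x : ℕ => negBinPmf β c x * fall x l) (poch β l * (c / (1 - c)) ^ l) := by
  have hc1 : 0 < 1 - c := by linarith [le_abs_self c]
  refine hasSum_mul_fall_of_shift l
    (w' := fun x => poch β l * (c / (1 - c)) ^ l * negBinPmf (β + l) c x) (fun x => ?_)
    (by simpa using (hasSum_negBinPmf (β := β + l) hc).mul_left (poch β l * (c / (1 - c)) ^ l))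
  have hpow : (c / (1 - c)) ^ l * (1 - c) ^ l = c ^ l := by
    rw [← mul_pow, div_mul_cancel₀ _ hc1.ne']
  unfold negBinPmf
  rw [Real.rpow_add_natCast hc1.ne', add_comm x l, poch_add, add_comm l x, pow_add]
  linear_combination
    (1 - c) ^ β * (c ^ x * c ^ l) * (poch β l * poch (β + l) x) *
      fall_add_natCast_div_factorial x l -
    poch β l * (1 - c) ^ β * c ^ x * poch (β + l) x / x.factorial * hpow

lemma meixner_eq {β c : ℝ} (hc : c ≠ 0) (n x : ℕ) :
    meixner β c n x = (-1) ^ n * √(c ^ n * poch β n / n.factorial) *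
      Δ_[1] ^[n] (fun k => fall x k / (poch β k * (c / (1 - c)) ^ k)) 0 := by
  rw [mul_comm ((-1) ^ n), mul_assoc, ← sum_neg_one_pow_mul_choose_mul, meixner]
  congr 1
  refine Finset.sum_congr rfl fun k _ => ?_
  have hbase : 1 - c⁻¹ = -(c / (1 - c))⁻¹ := by
    rw [inv_div]
    field_simp
    ring
  have hsign : ((-1 : ℝ) ^ k) * (-1) ^ k = 1 := by rw [← mul_pow]; simp
  rw [poch_neg, poch_neg, hbase, neg_pow (c / (1 - c))⁻¹, fall_natCast_eq_factorial_mul_choose n,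
    inv_pow]
  generalize (c / (1 - c)) ^ k = r
  field_simp
  linear_combination (n.choose k : ℝ) * fall x k / (poch β k * r) * hsign

theorem isOrthonormalSystem_meixner {β c : ℝ} (hβ : 0 < β) (hc : 0 < c) (hc1 : c < 1) :
    IsOrthonormalSystem (withWeight .count (negBinPmf β c)) (meixner β c) := by
  have hw₀ := negBinPmf_nonneg hβ hc.le hc1.le
  have hM := hasSum_negBinPmf_mul_fall (β := β) (abs_lt.2 ⟨by linarith, hc1⟩)
  have hr : 0 < c / (1 - c) := div_pos hc (sub_pos.2 hc1)
  have hgram : ∀ j k : ℕ, ∫ x : ℕ, fall x j / (poch β j * (c / (1 - c)) ^ j) *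
      (fall x k / (poch β k * (c / (1 - c)) ^ k)) ∂withWeight .count (negBinPmf β c) =
        (∑ p ∈ antidiagonal k, (k.choose p.1 : ℝ) *
          (fall j p.1 * (c / (1 - c))⁻¹ ^ p.1 * poch (β + j) p.2)) / poch β k := fun j k => by
    simp only [div_mul_div_comm]
    rw [integral_div, integral_fall_mul_fall hw₀ hM, Finset.sum_div, Finset.sum_div]
    refine Finset.sum_congr rfl fun p hp => ?_
    have := (poch_pos hβ j).ne'
    rw [poch_add, ← mem_antidiagonal.1 hp, inv_pow]
    generalize c / (1 - c) = r at hr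
    field_simp
    ring
  refine (funext₂ (meixner_eq hc.ne') : meixner β c = _) ▸
    .of_fwdDiff (h := fun n => c⁻¹ ^ n / poch β n)
      (fun k => ?_) (by simp [fall_zero, poch_zero]) (fun j n => ?_) (by simp [poch_zero])
      fun n => ?_
  · simpa only [div_eq_mul_inv] using (memLp_fall hw₀ hM k).mul_const _
  · have hone : 1 + (c / (1 - c))⁻¹ = c⁻¹ := by rw [inv_div]; field_simp; ring
    simp only [hgram]
    rw [fwdDiff_iter_sum_choose_mul_poch_div_poch hβ, hone]
  · have := poch_pos hβ n
    rw [mul_pow, ← pow_mul', (even_two_mul n).neg_one_pow, Real.sq_sqrt (by positivity), inv_pow]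
    field_simp

/-! ### Laws with a diagonal expansion -/

lemma HasJointDensity.measureReal_eq_setIntegral {E : Type*} [MeasurableSpace E]
    {κ : Measure (ℝ × ℝ)} {ref : Measure E} {emb : E → ℝ × ℝ} {h : E → ℝ}
    (hκ : HasJointDensity κ ref emb h) (hemb : Measurable emb) (hh : AEMeasurable h ref)
    {S : Set (ℝ × ℝ)} (hS : MeasurableSet S) : κ.real S = ∫ z in emb ⁻¹' S, h z ∂ref := by
  rw [measureReal_def, hκ.2, Measure.map_apply hemb hS, withDensity_apply _ (hemb hS),
    integral_eq_lintegral_of_nonneg_ae (ae_restrict_of_ae hκ.1) hh.restrict.aestronglyMeasurable]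

/-- `κ` has the density `∑ₙ ρⁿ φₙ(x) ψₙ(y)` with respect to a product measure `ν ⊗ ν'`, where
`φ` and `ψ` are orthonormal systems for `ν` and `ν'`. The spaces `E` and `F` are placed on the two
axes by `f` and `g`, so that discrete marginals are allowed. -/
inductive HasDiagonalExpansion (ρ : ℝ) (κ : Measure (ℝ × ℝ)) : Prop
  | intro {E F : Type} [MeasurableSpace E] [MeasurableSpace F] {ν : Measure E} {ν' : Measure F}
    {φ : ℕ → E → ℝ} {ψ : ℕ → F → ℝ} {f : E → ℝ} {g : F → ℝ}
    (hφ : IsOrthonormalSystem ν φ) (hψ : IsOrthonormalSystem ν' ψ)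
    (hf : Measurable f) (hg : Measurable g)
    (hκ : HasJointDensity κ (ν.prod ν') (fun z => (f z.1, g z.2))
      fun z => ∑' n, ρ ^ n * (φ n z.1 * ψ n z.2))

section Dependence

variable {E F : Type*} [MeasurableSpace E] [MeasurableSpace F] {ν : Measure E} {ν' : Measure F}
  {φ : ℕ → E → ℝ} {ψ : ℕ → F → ℝ} {f : E → ℝ} {g : F → ℝ} {ρ : ℝ} {κ : Measure (ℝ × ℝ)}
  {A B : Set ℝ}

lemma hasSum_measureReal_prod (hφ : IsOrthonormalSystem ν φ) (hψ : IsOrthonormalSystem ν' ψ)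
    (hf : Measurable f) (hg : Measurable g) (hρ : |ρ| < 1)
    (hκ : HasJointDensity κ (ν.prod ν') (fun z => (f z.1, g z.2))
      fun z => ∑' n, ρ ^ n * (φ n z.1 * ψ n z.2))
    (hA : MeasurableSet A) (hB : MeasurableSet B) :
    HasSum (fun n => ρ ^ n * ((∫ x in f ⁻¹' A, φ n x ∂ν) * ∫ y in g ⁻¹' B, ψ n y ∂ν'))
      (κ.real (A ×ˢ B)) := by
  have := hφ.isProbabilityMeasure
  have := hψ.isProbabilityMeasure
  have hint : ∀ n, Integrable (fun z : E × F => ρ ^ n * (φ n z.1 * ψ n z.2)) (ν.prod ν') :=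
    fun n => ((hφ.integrable n).mul_prod (hψ.integrable n)).const_mul _
  have hnorm : ∀ n, ∫ z in (f ⁻¹' A) ×ˢ (g ⁻¹' B), ‖ρ ^ n * (φ n z.1 * ψ n z.2)‖ ∂(ν.prod ν') ≤
      |ρ| ^ n := fun n => by
    refine (setIntegral_le_integral (hint n).norm (.of_forall fun _ => norm_nonneg _)).trans ?_
    simp only [norm_mul, norm_pow, Real.norm_eq_abs]
    rw [integral_const_mul, integral_prod_mul (fun x => |φ n x|) (fun y => |ψ n y|)]
    refine mul_le_of_le_one_right (by positivity) ?_
    exact mul_le_one₀ (hφ.integral_abs_le_one n) (integral_nonneg fun _ => abs_nonneg _)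
      (hψ.integral_abs_le_one n)
  have hsum := hasSum_integral_of_summable_integral_norm (fun n => (hint n).restrict)
    (Summable.of_nonneg_of_le (fun n => integral_nonneg fun _ => norm_nonneg _) hnorm
      (summable_geometric_of_lt_one (abs_nonneg ρ) hρ))
  simp only [integral_const_mul, setIntegral_prod_mul] at hsum
  rwa [hκ.measureReal_eq_setIntegral (by fun_prop) (.tsum fun n => (hint n).aemeasurable)
    (hA.prod hB)]

lemma abs_measureReal_prod_sub_le_of_abs_lt_one
    (hφ : IsOrthonormalSystem ν φ) (hψ : IsOrthonormalSystem ν' ψ)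
    (hf : Measurable f) (hg : Measurable g) (hρ : |ρ| < 1)
    (hκ : HasJointDensity κ (ν.prod ν') (fun z => (f z.1, g z.2))
      fun z => ∑' n, ρ ^ n * (φ n z.1 * ψ n z.2))
    (hA : MeasurableSet A) (hB : MeasurableSet B) :
    |κ.real (A ×ˢ B) - κ.real (A ×ˢ Set.univ) * κ.real (Set.univ ×ˢ B)| ≤ |ρ| := by
  have hAB := hasSum_measureReal_prod hφ hψ hf hg hρ hκ hA hB
  have hfst : κ.real (A ×ˢ Set.univ) = ∫ x in f ⁻¹' A, φ 0 x ∂ν := by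
    refine (hasSum_measureReal_prod hφ hψ hf hg hρ hκ hA .univ).unique ?_
    convert hasSum_ite_eq 0 (∫ x in f ⁻¹' A, φ 0 x ∂ν) using 2 with n
    rcases eq_or_ne n 0 with rfl | hn <;> simp [hψ.integral_eq, *]
  have hsnd : κ.real (Set.univ ×ˢ B) = ∫ y in g ⁻¹' B, ψ 0 y ∂ν' := by
    refine (hasSum_measureReal_prod hφ hψ hf hg hρ hκ .univ hB).unique ?_
    convert hasSum_ite_eq 0 (∫ y in g ⁻¹' B, ψ 0 y ∂ν') using 2 with n
    rcases eq_or_ne n 0 with rfl | hn <;> simp [hφ.integral_eq, *]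
  set a : ℕ → ℝ := fun n => ∫ x in f ⁻¹' A, φ n x ∂ν
  set b : ℕ → ℝ := fun n => ∫ y in g ⁻¹' B, ψ n y ∂ν'
  have htail : HasSum (fun n => ρ ^ (n + 1) * (a (n + 1) * b (n + 1)))
      (κ.real (A ×ˢ B) - κ.real (A ×ˢ Set.univ) * κ.real (Set.univ ×ˢ B)) := by
    simpa [hfst, hsnd] using (hasSum_nat_add_iff' 1).2 hAB
  refine le_of_tendsto' htail.tendsto_sum_nat.abs fun N => ?_
  calc |∑ n ∈ Finset.range N, ρ ^ (n + 1) * (a (n + 1) * b (n + 1))|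
      ≤ ∑ n ∈ Finset.range N, |ρ| * |a (n + 1) * b (n + 1)| := by
        refine (Finset.abs_sum_le_sum_abs _ _).trans (Finset.sum_le_sum fun n _ => ?_)
        rw [abs_mul, abs_pow]
        gcongr
        exact pow_le_of_le_one (abs_nonneg ρ) hρ.le n.succ_ne_zero
    _ ≤ |ρ| * ∑ n ∈ Finset.range (N + 1), |a n * b n| := by
        rw [← Finset.mul_sum, Finset.sum_range_succ']
        gcongr
        exact le_add_of_nonneg_right (abs_nonneg _)
    _ ≤ |ρ| := mul_le_of_le_one_right (abs_nonneg ρ)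
        (hφ.sum_abs_setIntegral_mul_le_one hψ _ (hf hA) (hg hB))

theorem HasDiagonalExpansion.abs_measureReal_prod_sub_le [IsProbabilityMeasure κ]
    (hκ : HasDiagonalExpansion ρ κ) (hA : MeasurableSet A) (hB : MeasurableSet B) :
    |κ.real (A ×ˢ B) - κ.real (A ×ˢ Set.univ) * κ.real (Set.univ ×ˢ B)| ≤ |ρ| := by
  obtain ⟨hφ, hψ, hf, hg, hdens⟩ := hκ
  rcases lt_or_ge |ρ| 1 with hρ | hρ
  · exact abs_measureReal_prod_sub_le_of_abs_lt_one hφ hψ hf hg hρ hdens hA hB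
  · have hprod : κ.real (A ×ˢ Set.univ) * κ.real (Set.univ ×ˢ B) ≤ 1 :=
      mul_le_one₀ measureReal_le_one measureReal_nonneg measureReal_le_one
    refine (abs_sub_le_of_nonneg_of_le measureReal_nonneg measureReal_le_one ?_ hprod).trans hρ
    exact mul_nonneg measureReal_nonneg measureReal_nonneg

end Dependence

/-! ### Diagonal expansions of the Lancaster laws -/

instance : SFinite lebPos := by
  unfold lebPos
  infer_instance

lemma HasDiagonalExpansion.of_withWeight {E F : Type} [MeasurableSpace E] [MeasurableSpace F]
    {ν : Measure E} {ν' : Measure F} [SFinite ν] [SFinite ν'] {w : E → ℝ} {w' : F → ℝ}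
    {φ : ℕ → E → ℝ} {ψ : ℕ → F → ℝ} {f : E → ℝ} {g : F → ℝ} {ρ : ℝ} {κ : Measure (ℝ × ℝ)}
    {emb : E × F → ℝ × ℝ} {h : E × F → ℝ} (hκ : HasJointDensity κ (ν.prod ν') emb h)
    (hemb : ∀ z, emb z = (f z.1, g z.2))
    (hh : ∀ z, h z = w z.1 * w' z.2 * ∑' n, ρ ^ n * (φ n z.1 * ψ n z.2))
    (hφ : IsOrthonormalSystem (withWeight ν w) φ) (hψ : IsOrthonormalSystem (withWeight ν' w') ψ)
    (hw : Measurable w) (hw' : Measurable w') (hw₀ : 0 ≤ᵐ[ν] w) (hw'₀ : 0 ≤ᵐ[ν'] w')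
    (hφm : ∀ n, Measurable (φ n)) (hψm : ∀ n, Measurable (ψ n))
    (hf : Measurable f) (hg : Measurable g) : HasDiagonalExpansion ρ κ := by
  obtain rfl : emb = _ := funext hemb
  obtain rfl : h = _ := funext hh
  exact .intro hφ hψ hf hg <| hκ.withWeight hw hw' (.tsum fun n => by fun_prop) hw₀ hw'₀

lemma measurable_laguerre (a : ℝ) (n : ℕ) : Measurable (laguerre a n) := by
  unfold laguerre
  fun_prop

lemma IsBivariateGamma.hasDiagonalExpansion {α ρ : ℝ} {κ : Measure (ℝ × ℝ)} (hα : 0 < α)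
    (hκ : IsBivariateGamma α ρ κ) : HasDiagonalExpansion ρ κ := by
  have hφ := isOrthonormalSystem_laguerre hα
  have hφm n := (measurable_laguerre (α - 1) n).const_mul √(n.factorial / poch α n)
  have hw := measurable_gammaDensity α
  have hw₀ := gammaDensity_nonneg_ae hα
  refine .of_withWeight (f := id) (g := id) hκ.2.2 (fun _ => rfl) (fun z => ?_) hφ hφ hw hw hw₀ hw₀
    hφm hφm measurable_id measurable_id
  refine congrArg _ (tsum_congr fun n => ?_)
  have hpoch := poch_pos hα n
  have hΓ := (Real.Gamma_pos_of_pos hα).ne'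
  have hsq := Real.mul_self_sqrt (show 0 ≤ (n.factorial : ℝ) / poch α n by positivity)
  rw [Gamma_add_natCast hα, mul_div_mul_right _ _ hΓ]
  linear_combination -(ρ ^ n * laguerre (α - 1) n z.1 * laguerre (α - 1) n z.2) * hsq

lemma IsBivariatePoisson.hasDiagonalExpansion {a ρ : ℝ} {κ : Measure (ℝ × ℝ)} (ha : 0 < a)
    (hκ : IsBivariatePoisson a ρ κ) : HasDiagonalExpansion ρ κ := by
  have hφ := isOrthonormalSystem_charlier ha
  have hw₀ := poissonPmf_nonneg ha.le
  refine .of_withWeight (f := Nat.cast) (g := Nat.cast) hκ.2.2 (fun _ => rfl) (fun z => ?_) hφ hφ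
    .of_discrete .of_discrete (.of_forall hw₀) (.of_forall hw₀) (fun _ => .of_discrete)
    (fun _ => .of_discrete) .of_discrete .of_discrete
  simp only [poissonJoint, mul_assoc]

lemma IsBivariateNegBin.hasDiagonalExpansion {β c ρ : ℝ} {κ : Measure (ℝ × ℝ)} (hβ : 0 < β)
    (hc : 0 < c) (hc1 : c < 1) (hκ : IsBivariateNegBin β c ρ κ) : HasDiagonalExpansion ρ κ := by
  have hφ := isOrthonormalSystem_meixner hβ hc hc1
  have hw₀ := negBinPmf_nonneg hβ hc.le hc1.le
  refine .of_withWeight (f := Nat.cast) (g := Nat.cast) hκ.2.2 (fun _ => rfl) (fun z => ?_) hφ hφ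
    .of_discrete .of_discrete (.of_forall hw₀) (.of_forall hw₀) (fun _ => .of_discrete)
    (fun _ => .of_discrete) .of_discrete .of_discrete
  simp only [negBinJoint, mul_assoc]

lemma IsBivariateGammaNegBin.hasDiagonalExpansion {β c α ρ : ℝ} {κ : Measure (ℝ × ℝ)}
    (hβ : 0 < β) (hc : 0 < c) (hc1 : c < 1) (hα : 0 < α)
    (hκ : IsBivariateGammaNegBin β c α ρ κ) : HasDiagonalExpansion ρ κ := by
  refine .of_withWeight (f := Nat.cast) (g := id) hκ.2.2 (fun _ => rfl) (fun z => ?_)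
    (isOrthonormalSystem_meixner hβ hc hc1) (isOrthonormalSystem_laguerre hα)
    .of_discrete (measurable_gammaDensity α) (.of_forall (negBinPmf_nonneg hβ hc.le hc1.le))
    (gammaDensity_nonneg_ae hα) (fun _ => .of_discrete)
    (fun n => (measurable_laguerre _ n).const_mul _) .of_discrete measurable_id
  exact congrArg _ (tsum_congr fun n => by ring)

theorem IsLancaster.hasDiagonalExpansion {ρ : ℝ} {κ : Measure (ℝ × ℝ)} (hκ : IsLancaster ρ κ) :
    HasDiagonalExpansion ρ κ := by
  obtain ⟨α, hα, -, h⟩ | ⟨a, ha, h⟩ | ⟨β, c, hβ, hc, hc1, h⟩ | ⟨β, c, α, hβ, hc, hc1, hα, h⟩ := hκ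
  · exact h.hasDiagonalExpansion hα
  · exact h.hasDiagonalExpansion ha
  · exact h.hasDiagonalExpansion hβ hc hc1
  · exact h.hasDiagonalExpansion hβ hc hc1 hα

/-! ### A strong law for bounded, weakly correlated variables -/

section StrongLaw

variable {Ω : Type*} [MeasurableSpace Ω] {P : Measure Ω}

lemma ae_tendsto_zero_of_summable_integral {Y : ℕ → Ω → ℝ} (hY : ∀ k, Integrable (Y k) P)
    (hY₀ : ∀ k ω, 0 ≤ Y k ω) (hsum : Summable fun k => ∫ ω, Y k ω ∂P) :
    ∀ᵐ ω ∂P, Tendsto (fun k => Y k ω) atTop (𝓝 0) := by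
  have hm : ∀ k, AEMeasurable (fun ω => ENNReal.ofReal (Y k ω)) P := fun k =>
    (hY k).aemeasurable.ennreal_ofReal
  have hfin : ∫⁻ ω, ∑' k, ENNReal.ofReal (Y k ω) ∂P ≠ ⊤ := by
    rw [lintegral_tsum hm]
    simp only [← fun k => ofReal_integral_eq_lintegral_ofReal (hY k) (.of_forall (hY₀ k))]
    rw [← ENNReal.ofReal_tsum_of_nonneg (fun k => integral_nonneg (hY₀ k)) hsum]
    exact ENNReal.ofReal_ne_top
  filter_upwards [ae_lt_top' (AEMeasurable.tsum hm) hfin] with ω hω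
  have h := (ENNReal.tendsto_toReal ENNReal.zero_ne_top).comp
    (ENNReal.tendsto_atTop_zero_of_tsum_ne_top hω.ne)
  simpa only [Function.comp_def, ENNReal.toReal_ofReal (hY₀ _ _), ENNReal.toReal_zero] using h

lemma exists_pow_ae_tendsto_sub_integral [IsFiniteMeasure P] {A : ℕ → Ω → ℝ}
    (hA : ∀ m, MemLp (A m) 2 P) {ε : ℝ} (hε : 0 < ε)
    (hO : (fun m => Var[A m; P]) =O[atTop] fun m : ℕ => (m : ℝ) ^ (-ε)) :
    ∃ q ≠ 0, ∀ᵐ ω ∂P, Tendsto (fun k : ℕ => A (k ^ q) ω - ∫ ω', A (k ^ q) ω' ∂P) atTop (𝓝 0) := by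
  obtain ⟨q, hq⟩ := exists_nat_gt (1 / ε)
  have hqε : 1 < q * ε := (div_lt_iff₀ hε).1 hq
  have hq₀ : q ≠ 0 := by
    rintro rfl
    norm_num at hqε
  have hsum : Summable fun k : ℕ => Var[A (k ^ q); P] := by
    refine summable_of_isBigO_nat (Real.summable_nat_rpow.2 (show -(q * ε) < -1 by linarith)) ?_
    refine (hO.comp_tendsto (tendsto_pow_atTop hq₀)).congr_right fun k => ?_
    rw [Function.comp_apply, Nat.cast_pow, ← Real.rpow_natCast, ← Real.rpow_mul k.cast_nonneg,
      mul_neg]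
  simp only [variance_eq_integral (hA _).aemeasurable] at hsum
  refine ⟨q, hq₀, ?_⟩
  filter_upwards [ae_tendsto_zero_of_summable_integral
    (fun k => ((hA (k ^ q)).sub (memLp_const _)).integrable_sq) (fun k ω => sq_nonneg _) hsum]
    with ω hω
  rw [tendsto_zero_iff_abs_tendsto_zero]
  simpa only [Function.comp_def, Real.sqrt_sq_eq_abs, Pi.sub_apply, Real.sqrt_zero] using hω.sqrt

lemma eventually_succ_pow_le (q : ℕ) {a : ℝ} (ha : 1 < a) :
    ∀ᶠ k : ℕ in atTop, (((k + 1) ^ q : ℕ) : ℝ) ≤ a * ((k ^ q : ℕ) : ℝ) := by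
  have hlim : Tendsto (fun k : ℕ => (1 + 1 / (k : ℝ)) ^ q) atTop (𝓝 1) := by
    simpa using ((tendsto_one_div_atTop_nhds_zero_nat (𝕜 := ℝ)).const_add 1).pow q
  filter_upwards [hlim.eventually_le_const ha, eventually_gt_atTop 0] with k hk hk₀
  have hk₀' : (k : ℝ) ≠ 0 := by positivity
  have hsucc : (k : ℝ) + 1 = (1 + 1 / (k : ℝ)) * k := by field_simp
  push_cast
  rw [hsucc, mul_pow]
  gcongr

lemma tendsto_average_zero_of_tendsto_pow {x : ℕ → ℝ} {b : ℝ} (hx : ∀ i, -b ≤ x i) {q : ℕ}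
    (hq : q ≠ 0) (hsub : Tendsto (fun k : ℕ => ((k ^ q : ℕ) : ℝ)⁻¹ *
      ∑ i ∈ Finset.range (k ^ q), x i) atTop (𝓝 0)) :
    Tendsto (fun m : ℕ => (m : ℝ)⁻¹ * ∑ i ∈ Finset.range m, x i) atTop (𝓝 0) := by
  set S : ℕ → ℝ := fun m => ∑ i ∈ Finset.range m, (x i + b) with hS
  have hSmono : Monotone S := monotone_nat_of_le_succ fun m => by
    simp only [hS, Finset.sum_range_succ]
    linarith [hx m]
  have hSdiv : (fun m : ℕ => S m / m) =ᶠ[atTop]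
      fun m => (m : ℝ)⁻¹ * ∑ i ∈ Finset.range m, x i + b := by
    filter_upwards [eventually_ne_atTop 0] with m hm
    simp only [hS, Finset.sum_add_distrib, Finset.sum_const, Finset.card_range, nsmul_eq_mul]
    field_simp
  have hlim : Tendsto (fun m => S m / m) atTop (𝓝 b) := by
    refine tendsto_div_of_monotone_of_exists_subseq_tendsto_div S b hSmono fun a ha =>
      ⟨fun k => k ^ q, eventually_succ_pow_le q ha, tendsto_pow_atTop hq, ?_⟩
    have := hsub.add_const b
    rw [zero_add] at this
    exact this.congr' ((tendsto_pow_atTop hq).eventually hSdiv.symm)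
  simpa using (hlim.congr' hSdiv).sub_const b

lemma isBigO_rpow_neg_of_le {ε s : ℝ} (h : ε ≤ s) :
    (fun m : ℕ => (m : ℝ) ^ (-s)) =O[atTop] fun m : ℕ => (m : ℝ) ^ (-ε) := by
  refine .of_norm_eventuallyLE ?_
  filter_upwards [eventually_ge_atTop 1] with m hm
  rw [Real.norm_of_nonneg (by positivity)]
  exact Real.rpow_le_rpow_of_exponent_le (mod_cast hm) (neg_le_neg h)

variable [IsProbabilityMeasure P] {X : ℕ → Ω → ℝ} {r : ℕ → ℕ → ℝ}

lemma variance_sum_range_le (hX : ∀ i, Measurable (X i)) (h01 : ∀ i ω, X i ω ∈ Set.Icc 0 1)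
    (hcov : ∀ i j, i ≠ j → |cov[X i, X j; P]| ≤ |r i j|) (m : ℕ) :
    Var[fun ω => ∑ i ∈ Finset.range m, X i ω; P] ≤
      m + ∑ i ∈ Finset.range m, ∑ j ∈ Finset.range m, |r i j| := by
  have hle : ∀ i j, cov[X i, X j; P] ≤ (if j = i then 1 else 0) + |r i j| := fun i j => by
    split_ifs with hij
    · have hvar := variance_le_sq_of_bounded (.of_forall (h01 i)) (hX i).aemeasurable (μ := P)
      rw [hij, covariance_self (hX i).aemeasurable]
      linarith [abs_nonneg (r i i)]
    · linarith [le_of_abs_le (hcov i j (Ne.symm hij))]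
  rw [variance_fun_sum' fun i _ =>
    memLp_of_bounded (.of_forall (h01 i)) (hX i).aestronglyMeasurable 2]
  refine (Finset.sum_le_sum fun i _ => Finset.sum_le_sum fun j _ => hle i j).trans_eq ?_
  simp only [Finset.sum_add_distrib]
  congr 1
  simp +contextual [Finset.sum_ite_eq']

lemma isBigO_variance_average (hX : ∀ i, Measurable (X i)) (h01 : ∀ i ω, X i ω ∈ Set.Icc 0 1)
    (hcov : ∀ i j, i ≠ j → |cov[X i, X j; P]| ≤ |r i j|) {δ : ℝ}
    (hO : (fun m : ℕ => ((m : ℝ) ^ 2)⁻¹ * ∑ i ∈ Finset.range m, ∑ j ∈ Finset.range m, |r i j|)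
      =O[atTop] fun m : ℕ => (m : ℝ) ^ (-δ)) :
    (fun m : ℕ => Var[fun ω => (m : ℝ)⁻¹ * ∑ i ∈ Finset.range m, X i ω; P]) =O[atTop]
      fun m : ℕ => (m : ℝ) ^ (-min δ 1) := by
  refine IsBigO.trans (.of_norm_eventuallyLE ?_)
    ((isBigO_rpow_neg_of_le (min_le_right δ 1)).add
      (hO.trans (isBigO_rpow_neg_of_le (min_le_left δ 1))))
  filter_upwards [eventually_ne_atTop 0] with m hm
  rw [Real.norm_of_nonneg (variance_nonneg _ _), variance_const_mul]
  refine (mul_le_mul_of_nonneg_left (variance_sum_range_le hX h01 hcov m) (sq_nonneg _)).trans_eq ?_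
  rw [Real.rpow_neg_one]
  field_simp

theorem convergesToMean_average (hX : ∀ i, Measurable (X i))
    (h01 : ∀ i ω, X i ω ∈ Set.Icc 0 1) (hcov : ∀ i j, i ≠ j → |cov[X i, X j; P]| ≤ |r i j|)
    {δ : ℝ} (hδ : 0 < δ)
    (hO : (fun m : ℕ => ((m : ℝ) ^ 2)⁻¹ * ∑ i ∈ Finset.range m, ∑ j ∈ Finset.range m, |r i j|)
      =O[atTop] fun m : ℕ => (m : ℝ) ^ (-δ)) :
    ConvergesToMean P fun m ω => (m : ℝ)⁻¹ * ∑ i ∈ Finset.range m, X i ω := by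
  have hmem : ∀ i, MemLp (X i) 2 P := fun i =>
    memLp_of_bounded (.of_forall (h01 i)) (hX i).aestronglyMeasurable 2
  have hint := fun i => (hmem i).integrable one_le_two
  obtain ⟨q, hq, hsub⟩ := exists_pow_ae_tendsto_sub_integral
    (fun m : ℕ => (memLp_finsetSum (Finset.range m) fun i _ => hmem i).const_mul (m : ℝ)⁻¹)
    (lt_min hδ one_pos) (isBigO_variance_average hX h01 hcov hO)
  have hcentre : ∀ (m : ℕ) ω, (m : ℝ)⁻¹ * ∑ i ∈ Finset.range m, X i ω -
      ∫ ω', (m : ℝ)⁻¹ * ∑ i ∈ Finset.range m, X i ω' ∂P =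
        (m : ℝ)⁻¹ * ∑ i ∈ Finset.range m, (X i ω - ∫ ω', X i ω' ∂P) := fun m ω => by
    rw [integral_const_mul, integral_finsetSum _ fun i _ => hint i, ← mul_sub,
      Finset.sum_sub_distrib]
  simp only [ConvergesToMean, hcentre] at hsub ⊢
  filter_upwards [hsub] with ω hω
  refine (tendsto_zero_iff_abs_tendsto_zero _).1
    (tendsto_average_zero_of_tendsto_pow (b := 1) (fun i => ?_) hq hω)
  have hmean : ∫ ω', X i ω' ∂P ≤ 1 := by
    simpa using integral_mono (hint i) (integrable_const 1) fun ω' => (h01 i ω').2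
  linarith [(h01 i ω).1]

end StrongLaw

lemma ConvergesToMean.mul_of_isBigO {Ω : Type*} [MeasurableSpace Ω] {P : Measure Ω}
    {Y : ℕ → Ω → ℝ} {a b : ℕ → ℝ} (hY : ConvergesToMean P fun m ω => a m * Y m ω)
    (hab : b =O[atTop] a) : ConvergesToMean P fun m ω => b m * Y m ω := by
  filter_upwards [hY] with ω hω
  simp only [integral_const_mul, ← mul_sub] at hω ⊢
  refine (tendsto_zero_iff_abs_tendsto_zero _).1 (IsBigO.trans_tendsto ?_
    ((tendsto_zero_iff_abs_tendsto_zero _).2 hω))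
  exact hab.mul (isBigO_refl _ _)

/-! ### Rejection indicators -/

namespace TestingProblem

variable {Ω : Type*} [MeasurableSpace Ω] {P : Measure Ω} (T : TestingProblem P)

/-- The values of the `i`-th statistic that lead to a rejection. -/
def rejectionRegion (t : ℝ) (i : ℕ) : Set ℝ := {x | 1 - cdf (T.law i T.μ₀) x ≤ t}

/-- Every pair of statistics, taken in one of its two orders, has a diagonal expansion with ratio
its correlation: the common feature of the Lancaster laws that controls covariances. -/
def PairwiseDiagonal : Prop :=
  ∀ i j : ℕ, i ≠ j →
    HasDiagonalExpansion (T.ρ i j) (P.map fun ω => (T.ζ i ω, T.ζ j ω)) ∨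
    HasDiagonalExpansion (T.ρ i j) (P.map fun ω => (T.ζ j ω, T.ζ i ω))

variable {T}

lemma PairwiseLancaster.pairwiseDiagonal (hT : T.PairwiseLancaster) : T.PairwiseDiagonal :=
  fun i j hij => (hT i j hij).imp IsLancaster.hasDiagonalExpansion IsLancaster.hasDiagonalExpansion

variable (T) (t : ℝ)

lemma measurableSet_rejectionRegion (i : ℕ) : MeasurableSet (T.rejectionRegion t i) :=
  measurableSet_le ((monotone_cdf _).measurable.const_sub 1) measurable_const

lemma reject_eq (i : ℕ) : T.reject t i = (T.ζ i ⁻¹' T.rejectionRegion t i).indicator 1 := rfl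

lemma measurableSet_reject (i : ℕ) : MeasurableSet (T.ζ i ⁻¹' T.rejectionRegion t i) :=
  T.measurable_ζ i (T.measurableSet_rejectionRegion t i)

lemma measurable_reject (i : ℕ) : Measurable (T.reject t i) :=
  measurable_one.indicator (T.measurableSet_reject t i)

lemma reject_mem_Icc (i : ℕ) (ω : Ω) : T.reject t i ω ∈ Set.Icc (0 : ℝ) 1 := by
  by_cases hω : T.pValue i ω ≤ t <;> simp [reject, hω]

lemma isBigO_inv_m₀ (hlim : 0 < liminf (fun m : ℕ => (T.m₀ m : ℝ) / (m : ℝ)) atTop) :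
    (fun m => (T.m₀ m : ℝ)⁻¹) =O[atTop] fun m : ℕ => (m : ℝ)⁻¹ := by
  obtain ⟨ε, hε, hεlim⟩ := exists_between hlim
  refine .of_bound ε⁻¹ ?_
  filter_upwards [eventually_lt_of_lt_liminf hεlim (isBoundedUnder_of ⟨0, fun m => by positivity⟩),
    eventually_gt_atTop 0] with m hm hm₀
  rw [lt_div_iff₀ (mod_cast hm₀)] at hm
  rw [norm_inv, norm_inv, RCLike.norm_natCast, RCLike.norm_natCast, ← mul_inv]
  exact inv_anti₀ (by positivity) hm.le

variable [IsProbabilityMeasure P]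

lemma covariance_reject (i j : ℕ) :
    cov[T.reject t i, T.reject t j; P] =
      P.real (T.ζ i ⁻¹' T.rejectionRegion t i ∩ T.ζ j ⁻¹' T.rejectionRegion t j) -
        P.real (T.ζ i ⁻¹' T.rejectionRegion t i) * P.real (T.ζ j ⁻¹' T.rejectionRegion t j) := by
  have hmem : ∀ i, MemLp (T.reject t i) 2 P := fun i => memLp_of_bounded
    (.of_forall (T.reject_mem_Icc t i)) (T.measurable_reject t i).aestronglyMeasurable 2
  rw [covariance_eq_sub (hmem i) (hmem j), reject_eq, reject_eq, ← Set.inter_indicator_one,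
    integral_indicator_one (T.measurableSet_reject t i),
    integral_indicator_one (T.measurableSet_reject t j),
    integral_indicator_one ((T.measurableSet_reject t i).inter (T.measurableSet_reject t j))]

lemma abs_covariance_reject_le_of_hasDiagonalExpansion {i j : ℕ} {ρ : ℝ}
    (h : HasDiagonalExpansion ρ (P.map fun ω => (T.ζ i ω, T.ζ j ω))) :
    |cov[T.reject t i, T.reject t j; P]| ≤ |ρ| := by
  have hm : Measurable fun ω => (T.ζ i ω, T.ζ j ω) := (T.measurable_ζ i).prodMk (T.measurable_ζ j)
  have := Measure.isProbabilityMeasure_map (μ := P) hm.aemeasurable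
  have hA := T.measurableSet_rejectionRegion t i
  have hB := T.measurableSet_rejectionRegion t j
  have hbound := h.abs_measureReal_prod_sub_le hA hB
  rw [map_measureReal_apply hm (hA.prod hB), map_measureReal_apply hm (hA.prod .univ),
    map_measureReal_apply hm (MeasurableSet.univ.prod hB)] at hbound
  simpa only [covariance_reject, Set.mk_preimage_prod, Set.preimage_univ, Set.inter_univ,
    Set.univ_inter] using hbound

variable {T} {t}

theorem PairwiseDiagonal.abs_covariance_reject_le (hT : T.PairwiseDiagonal) {i j : ℕ}
    (hij : i ≠ j) : |cov[T.reject t i, T.reject t j; P]| ≤ |T.ρ i j| := by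
  rcases hT i j hij with h | h
  · exact T.abs_covariance_reject_le_of_hasDiagonalExpansion t h
  · rw [covariance_comm]
    exact T.abs_covariance_reject_le_of_hasDiagonalExpansion t h

theorem PairwiseDiagonal.convergesToMean_average_filter (hT : T.PairwiseDiagonal) {δ : ℝ}
    (hδ : 0 < δ) (hO : (fun m : ℕ => ((m : ℝ) ^ 2)⁻¹ * T.corrNorm m) =O[atTop]
      fun m : ℕ => (m : ℝ) ^ (-δ)) (p : ℕ → Prop) [DecidablePred p] :
    ConvergesToMean P fun m ω => (m : ℝ)⁻¹ * ∑ i ∈ Finset.range m with p i, T.reject t i ω := by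
  simp only [Finset.sum_filter]
  refine convergesToMean_average (fun i => ?_) (fun i ω => ?_) (fun i j hij => ?_) hδ hO
  · split_ifs
    exacts [T.measurable_reject t i, measurable_const]
  · split_ifs
    exacts [T.reject_mem_Icc t i ω, ⟨le_rfl, zero_le_one⟩]
  · by_cases hi : p i <;> by_cases hj : p j <;> simp only [hi, hj, if_true, if_false]
    · exact hT.abs_covariance_reject_le hij
    all_goals simp [covariance]

end TestingProblem

end Lancaster

open Lancaster in
theorem theorem1_general {Ω : Type*} [MeasurableSpace Ω] {P : Measure Ω} [IsProbabilityMeasure P]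
    {T : TestingProblem P} (hT : T.PairwiseDiagonal) (t : ℝ) :
    (∀ i j : ℕ, i ≠ j → |cov[T.reject t i, T.reject t j; P]| ≤ |T.ρ i j|) ∧
      ((∃ δ : ℝ, 0 < δ ∧ (fun m : ℕ => ((m : ℝ) ^ 2)⁻¹ * T.corrNorm m) =O[atTop]
          fun m : ℕ => (m : ℝ) ^ (-δ)) →
        (ConvergesToMean P (fun m ω => (m : ℝ)⁻¹ * T.R t m ω) ∧
          ConvergesToMean P (fun m ω => (m : ℝ)⁻¹ * T.V t m ω)) ∧
        (0 < liminf (fun m : ℕ => (T.m₀ m : ℝ) / (m : ℝ)) atTop →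
          ConvergesToMean P (fun m ω => (T.m₀ m : ℝ)⁻¹ * T.V t m ω))) := by
  classical
  refine ⟨fun i j hij => hT.abs_covariance_reject_le hij, fun ⟨δ, hδ, hO⟩ => ?_⟩
  have hR : ConvergesToMean P fun m ω => (m : ℝ)⁻¹ * T.R t m ω := by
    simpa [TestingProblem.R] using hT.convergesToMean_average_filter hδ hO fun _ => True
  have hV : ConvergesToMean P fun m ω => (m : ℝ)⁻¹ * T.V t m ω :=
    hT.convergesToMean_average_filter hδ hO fun i => T.μ i = T.μ₀
  exact ⟨⟨hR, hV⟩, fun hlim => hV.mul_of_isBigO (T.isBigO_inv_m₀ hlim)⟩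

theorem theorem1 (t : ℝ) (ht : t ∈ Set.Icc (0 : ℝ) 1) :
    ∃ C : ℝ, 0 < C ∧
      ∀ (Ω : Type*) [MeasurableSpace Ω] (P : Measure Ω) [IsProbabilityMeasure P]
        (T : Lancaster.TestingProblem P), T.PairwiseLancaster →
        (∀ i j : ℕ, i ≠ j → |cov[T.reject t i, T.reject t j; P]| ≤ C * |T.ρ i j|) ∧
        ((∃ δ : ℝ, 0 < δ ∧
            (fun m : ℕ => ((m : ℝ) ^ 2)⁻¹ * T.corrNorm m) =O[atTop]
              fun m : ℕ => (m : ℝ) ^ (-δ)) →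
          (Lancaster.ConvergesToMean P (fun m ω => (m : ℝ)⁻¹ * T.R t m ω) ∧
            Lancaster.ConvergesToMean P (fun m ω => (m : ℝ)⁻¹ * T.V t m ω)) ∧
          (0 < liminf (fun m : ℕ => (T.m₀ m : ℝ) / (m : ℝ)) atTop →
            Lancaster.ConvergesToMean P (fun m ω => (T.m₀ m : ℝ)⁻¹ * T.V t m ω))) := by
  refine ⟨1, one_pos, fun Ω _ P _ T hT => ?_⟩
  simpa only [one_mul] using theorem1_general hT.pairwiseDiagonal t
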